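/- A strict partition is a finite sequence $\lambda=(\lambda_1>\lambda_2>\dots>\lambda_{\ell}>0)$ of positive integers (possibly empty); put $\ell(\lambda)=\ell$, $|\lambda|=\sum_i\lambda_i$. Its shifted Young diagram is $D'(\lambda)=\{(i,j)\in\mathbb Z^2 : 1\le i\le \ell(\lambda),\ i\le j\le \lambda_i+i-1\}$, and $\mu\subset\lambda$ means $D'(\mu)\subseteq D'(\lambda)$. For strict partitions $\mu\subset\lambda$ let $g_{\lambda/\mu}$ be the number of standard shifted tableaux of shape $\lambda/\mu$, i.e. of bijections $T:D'(\lambda)\setminus D'(\mu)\to\{1,\dots,|\lambda|-|\mu|\}$ such that $T(i,j)<T(i+1,j)$ and $T(i,j)<T(i,j+1)$ whenever both boxes belong to $D'(\lambda)\setminus D'(\mu)$. Put $(x\downarrow k)=x(x-1)\cdots(x-k+1)$. For a strict partition $\mu$ with $l=\ell(\mu)$ and for $n\ge l$, the factorial Schur P-function in $n$ variables is the polynomial $$P^*_\mu(x_1,\dots,x_n)=\frac1{(n-l)!}\sum_{\omega\in S(n)}\ \prod_{i=1}^{l}\bigl(x_{\omega(i)}\downarrow\mu_i\bigr)\prod_{i\le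 l,\ i<j\le n}\frac{x_{\omega(i)}+x_{\omega(j)}}{x_{\omega(i)}-x_{\omega(j)}},$$ and $P^*_\mu(x_1,\dots,x_n)=0$ for $n<l$. **Theorem.** Let $\mu\subset\lambda$ be strict partitions. Then $$g_{\lambda/\mu}=g_{\lambda/\varnothing}\,\frac{P^*_\mu(\lambda_1,\dots,\lambda_{\ell(\lambda)})}{(|\lambda|\downarrow|\mu|)},$$ where $$g_{\lambda/\varnothing}=\frac{|\lambda|!}{\prod_{k=1}^{\ell(\lambda)}\lambda_k!}\prod_{1\le i<j\le\ell(\lambda)}\frac{\lambda_i-\lambda_j}{\lambda_i+\lambda_j}.$$ -/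

import Mathlib

open Finset

/-- A strict partition: the finite sequence of its (nonzero) parts, in strictly decreasing order. -/
structure StrictPartition where
  /-- the parts `λ₁ > λ₂ > ⋯ > λ_ℓ > 0` -/
  parts : List ℕ
  strict : parts.Pairwise (· > ·)
  pos : ∀ p ∈ parts, 0 < p

namespace StrictPartition

/-- The length `ℓ(λ)`. -/
def length (lam : StrictPartition) : ℕ := lam.parts.length

/-- The weight `|λ|`. -/
def size (lam : StrictPartition) : ℕ := lam.parts.sum

/-- The parts, indexed from `0` and continued by zeros: `lam.part i` is `λ_{i+1}`. -/
def part (lam : StrictPartition) (i : ℕ) : ℕ := lam.parts.getD i 0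

/-- The empty partition. -/
def empty : StrictPartition := ⟨[], List.Pairwise.nil, by simp⟩

/-- The shifted Young diagram. Rows and columns are indexed from `0`, so row `i`
consists of the boxes `(i, j)` with `i ≤ j < λ_{i+1} + i`. -/
def diagram (lam : StrictPartition) : Set (ℕ × ℕ) :=
  {b | b.1 < lam.length ∧ b.1 ≤ b.2 ∧ b.2 < lam.part b.1 + b.1}

/-- `μ ⊂ λ` : containment (not necessarily proper) of shifted diagrams. -/
instance : HasSubset StrictPartition := ⟨fun mu lam => mu.diagram ⊆ lam.diagram⟩

/-- Standard shifted Young tableaux of shape `λ/μ`: bijections from the skew shifted diagram to a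
chain of `|λ| - |μ|` labels which increase along rows and down columns. -/
def StandardTableau (lam mu : StrictPartition) : Type :=
  {T : ↥(lam.diagram \ mu.diagram) ≃ Fin (lam.size - mu.size) //
    ∀ b c : ↥(lam.diagram \ mu.diagram),
      (c.1 = (b.1.1 + 1, b.1.2) ∨ c.1 = (b.1.1, b.1.2 + 1)) → T b < T c}

/-- The dimension `g_{λ/μ}`: the number of standard shifted tableaux of shape `λ/μ`. -/
noncomputable def dimension (lam mu : StrictPartition) : ℕ := Nat.card (StandardTableau lam mu)

end StrictPartition

/-- The falling power `(x ↓ n) = x (x - 1) ⋯ (x - n + 1)`. -/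
def fallingPow {R : Type*} [CommRing R] (x : R) (n : ℕ) : R := ∏ k ∈ range n, (x - (k : R))

/-- With `l = ℓ(μ)`, the expression
`∏_{i ≤ l} (x_i ↓ μ_i) ∏_{i ≤ l, i < j ≤ n} (x_i + x_j) / (x_i - x_j)`. -/
def factorialSummand (mu : StrictPartition) {n : ℕ} {K : Type*} [Field K] (x : Fin n → K) : K :=
  (∏ i : Fin n with i.val < mu.length, fallingPow (x i) (mu.part i)) *
    ∏ i : Fin n with i.val < mu.length, ∏ j ∈ Ioi i, (x i + x j) / (x i - x j)

/-- The symmetrization `1/(n-l)! ∑_{ω ∈ S(n)} F(x_{ω(1)}, …, x_{ω(n)})` of the above expression. -/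
noncomputable def factorialSum (mu : StrictPartition) {n : ℕ} {K : Type*} [Field K]
    (x : Fin n → K) : K :=
  (((n - mu.length).factorial : ℕ) : K)⁻¹ *
    ∑ w : Equiv.Perm (Fin n), factorialSummand mu fun i => x (w i)

/-- `factorialSum` for indeterminates `x_1, …, x_n`, an element of `ℚ(x_1, …, x_n)`. -/
noncomputable def factorialRational (mu : StrictPartition) (n : ℕ) :
    FractionRing (MvPolynomial (Fin n) ℚ) :=
  factorialSum mu fun i =>
    algebraMap (MvPolynomial (Fin n) ℚ) (FractionRing (MvPolynomial (Fin n) ℚ)) (MvPolynomial.X i)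

/-! The rational function just defined is a polynomial. -/

/-- The numerator of `factorialSummand` over the common denominator `∏_{i < j} (x_j - x_i)`. -/
def factorialNumerator (mu : StrictPartition) {n : ℕ} {R : Type*} [CommRing R]
    (x : Fin n → R) : R :=
  (∏ i : Fin n with i.val < mu.length, fallingPow (x i) (mu.part i)) *
    ∏ i : Fin n, ∏ j ∈ Ioi i, if i.val < mu.length then -(x i + x j) else x j - x i

theorem map_factorialNumerator (mu : StrictPartition) {n : ℕ} {R S : Type*} [CommRing R]
    [CommRing S] (f : R →+* S) (x : Fin n → R) :
    f (factorialNumerator mu x) = factorialNumerator mu (fun i => f (x i)) := by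
  simp only [factorialNumerator, fallingPow, map_mul, map_prod, map_sub, map_natCast]
  congr 1
  refine prod_congr rfl fun i _ => prod_congr rfl fun j _ => ?_
  split_ifs <;> simp

theorem factorialSummand_mul (mu : StrictPartition) {n : ℕ} {K : Type*} [Field K]
    (x : Fin n → K) (hx : Function.Injective x) :
    factorialSummand mu x * (∏ i : Fin n, ∏ j ∈ Ioi i, (x j - x i)) = factorialNumerator mu x := by
  rw [factorialSummand, factorialNumerator, mul_assoc]
  congr 1
  rw [prod_filter, ← prod_mul_distrib]
  refine prod_congr rfl fun i _ => ?_
  split_ifs with h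
  · rw [← prod_mul_distrib]
    refine prod_congr rfl fun j hj => ?_
    have : x i - x j ≠ 0 := sub_ne_zero.2 fun e => (mem_Ioi.1 hj).ne (hx e)
    field_simp
    ring
  · rw [one_mul]

theorem vandermonde_perm {n : ℕ} {R : Type*} [CommRing R] (x : Fin n → R)
    (w : Equiv.Perm (Fin n)) :
    (∏ i : Fin n, ∏ j ∈ Ioi i, (x (w j) - x (w i))) =
      ((Equiv.Perm.sign w : ℤ) : R) * ∏ i : Fin n, ∏ j ∈ Ioi i, (x j - x i) := by
  rw [← Matrix.det_vandermonde x, ← Matrix.det_vandermonde (fun i => x (w i)),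
    ← Matrix.det_permute]
  rfl

theorem alternating_sum_eq_zero (mu : StrictPartition) {n : ℕ} {R : Type*} [CommRing R]
    (y : Fin n → R) {i j : Fin n} (hij : i ≠ j) (h : y i = y j) :
    ∑ w : Equiv.Perm (Fin n),
      ((Equiv.Perm.sign w : ℤ) : R) * factorialNumerator mu (fun k => y (w k)) = 0 := by
  have hy : ∀ k, y (Equiv.swap i j k) = y k := by
    intro k
    rcases eq_or_ne k i with rfl | hi
    · simp [h]
    rcases eq_or_ne k j with rfl | hj
    · simp [h]
    rw [Equiv.swap_apply_of_ne_of_ne hi hj]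
  refine sum_involution (fun w _ => Equiv.swap i j * w) ?_ ?_ ?_ ?_
  · intro w _
    simp [Equiv.Perm.sign_mul, Equiv.Perm.sign_swap hij, hy]
  · intro w _ _ e
    have : Equiv.swap i j = 1 := by simpa using e
    exact hij (Equiv.swap_eq_one_iff.1 this)
  · intro w _
    exact mem_univ _
  · intro w _
    rw [← mul_assoc, Equiv.swap_mul_self, one_mul]

theorem irreducible_X_sub_X {n : ℕ} {i j : Fin n} (h : i ≠ j) :
    Irreducible (MvPolynomial.X j - MvPolynomial.X i : MvPolynomial (Fin n) ℚ) := by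
  have hc : MvPolynomial.coeff (Finsupp.single j 1)
      (MvPolynomial.X j - MvPolynomial.X i : MvPolynomial (Fin n) ℚ) = 1 := by
    rw [MvPolynomial.coeff_sub, MvPolynomial.coeff_single_X, MvPolynomial.coeff_single_X]
    simp [h]
  refine MvPolynomial.irreducible_of_totalDegree_eq_one (le_antisymm ?_ ?_) ?_
  · refine (MvPolynomial.totalDegree_sub _ _).trans ?_
    simp [MvPolynomial.totalDegree_X]
  · have h1 := MvPolynomial.le_totalDegree (MvPolynomial.mem_support_iff.2 (hc ▸ one_ne_zero))
    simpa using h1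
  · intro c hd
    have h1 := hd (Finsupp.single j 1)
    rw [hc] at h1
    exact isUnit_of_dvd_one h1

theorem vandermonde_dvd {n : ℕ} (N : MvPolynomial (Fin n) ℚ)
    (hN : ∀ i j : Fin n, i < j →
      (MvPolynomial.X j - MvPolynomial.X i : MvPolynomial (Fin n) ℚ) ∣ N) :
    (∏ i : Fin n, ∏ j ∈ Ioi i,
      (MvPolynomial.X j - MvPolynomial.X i : MvPolynomial (Fin n) ℚ)) ∣ N := by
  rw [prod_sigma']
  refine prod_dvd_of_isRelPrime ?_ ?_
  · rintro ⟨i, j⟩ hp ⟨k, l⟩ hq hne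
    have hij : i < j := by simpa using hp
    have hkl : k < l := by simpa using hq
    refine (irreducible_X_sub_X hij.ne).isRelPrime_iff_not_dvd.2 ?_
    rintro ⟨c, hc⟩
    have := congrArg (MvPolynomial.eval fun m : Fin n => if m = j then (i.val : ℚ) else m.val) hc
    simp only [map_mul, map_sub, MvPolynomial.eval_X] at this
    rw [if_neg hij.ne, if_true, sub_self, zero_mul, sub_eq_zero] at this
    have h2 : (if l = j then i.val else l.val) = (if k = j then i.val else k.val) := by
      split_ifs at this ⊢ <;> exact_mod_cast this
    apply hne
    split_ifs at h2 with h3 h4 h4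
    · omega
    · have : i = k := Fin.ext h2
      subst this h3; rfl
    · omega
    · omega
  · rintro ⟨i, j⟩ hp
    exact hN i j (by simpa using hp)

theorem exists_factorialPolynomial (mu : StrictPartition) (n : ℕ) :
    ∃ p : MvPolynomial (Fin n) ℚ,
      algebraMap (MvPolynomial (Fin n) ℚ) (FractionRing (MvPolynomial (Fin n) ℚ)) p =
        factorialRational mu n := by
  set A := MvPolynomial (Fin n) ℚ
  set K := FractionRing A
  set x : Fin n → K := fun i => algebraMap A K (MvPolynomial.X i) with hxdef
  have hinj : Function.Injective (algebraMap A K) := IsFractionRing.injective A K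
  have hx : Function.Injective x := fun i j h => MvPolynomial.X_injective (hinj h)
  set N : A := ∑ w : Equiv.Perm (Fin n), ((Equiv.Perm.sign w : ℤ) : A) *
    factorialNumerator mu (fun k => (MvPolynomial.X (w k) : A)) with hN
  obtain ⟨q, hq⟩ : (∏ i : Fin n, ∏ j ∈ Ioi i, (MvPolynomial.X j - MvPolynomial.X i : A)) ∣ N := by
    refine vandermonde_dvd N fun i j hij => ?_
    rw [← Ideal.mem_span_singleton, ← Ideal.Quotient.eq_zero_iff_mem, hN, map_sum]
    simp only [map_mul, map_intCast, map_factorialNumerator]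
    refine alternating_sum_eq_zero mu
      (fun k => Ideal.Quotient.mk (Ideal.span {(MvPolynomial.X j - MvPolynomial.X i : A)})
        (MvPolynomial.X k)) hij.ne' ?_
    exact Ideal.Quotient.eq.2 (Ideal.mem_span_singleton_self _)
  have hD : (∏ i : Fin n, ∏ j ∈ Ioi i, (x j - x i)) ≠ 0 :=
    prod_ne_zero_iff.2 fun i _ => prod_ne_zero_iff.2 fun j hj =>
      sub_ne_zero.2 fun e => (mem_Ioi.1 hj).ne' (hx e)
  have hsum : (∑ w : Equiv.Perm (Fin n), factorialSummand mu fun i => x (w i)) =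
      algebraMap A K q := by
    apply mul_right_cancel₀ hD
    have h1 : algebraMap A K N = algebraMap A K q * ∏ i : Fin n, ∏ j ∈ Ioi i, (x j - x i) := by
      rw [hq, mul_comm, map_mul]
      simp only [map_prod, map_sub, hxdef]
    rw [← h1, hN, map_sum, sum_mul]
    refine sum_congr rfl fun w _ => ?_
    rw [map_mul, map_intCast, map_factorialNumerator,
      ← factorialSummand_mul mu (fun i => x (w i)) (hx.comp w.injective), vandermonde_perm x w]
    have hs : (((Equiv.Perm.sign w : ℤ) : K)) * ((Equiv.Perm.sign w : ℤ) : K) = 1 := by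
      rw [← Int.cast_mul, ← Units.val_mul, Int.units_mul_self]; simp
    linear_combination (-(factorialSummand mu fun i => x (w i)) *
      ∏ i : Fin n, ∏ j ∈ Ioi i, (x j - x i)) * hs
  refine ⟨MvPolynomial.C (((n - mu.length).factorial : ℚ)⁻¹) * q, ?_⟩
  rw [factorialRational, factorialSum, map_mul, ← hsum]
  congr 1
  refine eq_inv_of_mul_eq_one_left ?_
  rw [← map_natCast (algebraMap A K), ← map_mul, ← map_natCast (MvPolynomial.C (σ := Fin n)),
    ← map_mul, inv_mul_cancel₀ (by exact_mod_cast Nat.factorial_ne_zero _), map_one, map_one]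

/-- The factorial Schur P-polynomial `P*_{μ|n}` in `n` variables. -/
noncomputable def factorialSchurP (mu : StrictPartition) (n : ℕ) : MvPolynomial (Fin n) ℚ :=
  if mu.length ≤ n then Classical.choose (exists_factorialPolynomial mu n) else 0

/-! Fix `λ` with `n = ℓ(λ)`, write `N = |λ| - |μ|`, and let `H` be the product in the formula for
`g_{λ/∅}` with the factor `|λ|!` removed (`normalizedDimension`). The claim is `g_{λ/μ} = N! · H ·
P*_μ(λ)` for every strict `μ` with `ℓ(μ) ≤ n` and `|μ| ≤ |λ|`, where `g_{λ/μ}` is read as `0` if `μ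
⊄ λ` (`dimension_eq_rowSum`). Taking `μ = ∅`, where `P* = 1`, gives `g_{λ/∅} = |λ|! · H`, and
dividing gives the first formula.

The claim follows by induction on `N`, since both sides obey the same recurrence in `μ`. Removing
the box labelled 1 from a tableau shows that `g_{λ/μ}` is the sum of `g_{λ/ν}` over the `ν ⊂ λ`
obtained from `μ` by adding one box (`dimension_eq_sum`). On the other side there is a Pieri rule:
`(x_1 + ⋯ + x_n - |μ|) P*_μ` is the sum of `P*_ν` over all such `ν` with at most `n` rows
(`sum_rowSum_update`); at `x = λ` the factor is `N`.

For `N = 0` falling powers decide: `P*_μ(λ)` vanishes if `|μ| = |λ|` and `μ ≠ λ`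
(`rowSum_eq_zero_of_ne`), and `H · P*_λ(λ) = 1` because only the identity permutation contributes
(`normalizedDimension_mul_rowSum`). -/

namespace StrictPartition

/-! ### Strict partitions, their parts and containment. -/

theorem part_eq_zero {mu : StrictPartition} {i : ℕ} (h : mu.length ≤ i) : mu.part i = 0 := by
  rw [part, List.getD_eq_default _ _ h]

theorem part_eq_getElem (mu : StrictPartition) {i : ℕ} (h : i < mu.parts.length) :
    mu.part i = mu.parts[i] := by
  rw [part, List.getD_eq_getElem _ _ h]

theorem part_pos {mu : StrictPartition} {i : ℕ} (h : i < mu.length) : 0 < mu.part i := by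
  rw [part_eq_getElem mu h]
  exact mu.pos _ (List.getElem_mem h)

theorem part_pos_iff {mu : StrictPartition} {i : ℕ} : 0 < mu.part i ↔ i < mu.length := by
  refine ⟨fun h => ?_, part_pos⟩
  by_contra hi
  exact h.ne' (part_eq_zero (not_lt.1 hi))

theorem part_lt {mu : StrictPartition} {i j : ℕ} (hij : i < j) (h : i < mu.length) :
    mu.part j < mu.part i := by
  rcases lt_or_ge j mu.length with hj | hj
  · rw [part_eq_getElem mu h, part_eq_getElem mu hj]
    exact List.pairwise_iff_getElem.1 mu.strict i j h hj hij
  · rw [part_eq_zero hj]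
    exact part_pos h

theorem size_eq_sum (mu : StrictPartition) : mu.size = ∑ i ∈ range mu.length, mu.part i := by
  rw [size, ← Fin.sum_univ_getElem, ← Fin.sum_univ_eq_sum_range]
  exact Finset.sum_congr rfl fun i _ => (part_eq_getElem mu i.2).symm

theorem size_eq_sum_of_le (mu : StrictPartition) {n : ℕ} (h : mu.length ≤ n) :
    mu.size = ∑ i ∈ range n, mu.part i := by
  rw [size_eq_sum]
  refine sum_subset (range_mono h) fun i _ hi => part_eq_zero ?_
  simpa using hi

theorem ext_part {mu nu : StrictPartition} (h : ∀ i, mu.part i = nu.part i) : mu = nu := by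
  have hl : mu.parts.length = nu.parts.length := by
    refine le_antisymm ?_ ?_ <;> by_contra hlt <;> rw [not_le] at hlt
    · exact (part_pos (mu := mu) hlt).ne' (by rw [h]; exact part_eq_zero le_rfl)
    · exact (part_pos (mu := nu) hlt).ne' (by rw [← h]; exact part_eq_zero le_rfl)
  have hp : mu.parts = nu.parts := by
    refine List.ext_getElem hl fun i h1 h2 => ?_
    rw [← part_eq_getElem mu h1, ← part_eq_getElem nu h2, h]
  cases mu
  cases nu
  cases hp
  rfl

theorem mem_diagram {mu : StrictPartition} {b : ℕ × ℕ} :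
    b ∈ mu.diagram ↔ b.1 ≤ b.2 ∧ b.2 < mu.part b.1 + b.1 := by
  refine ⟨fun h => h.2, fun h => ⟨part_pos_iff.1 ?_, h⟩⟩
  omega

theorem subset_iff {mu lam : StrictPartition} : mu ⊆ lam ↔ ∀ i, mu.part i ≤ lam.part i := by
  refine ⟨fun h i => ?_, fun h b hb => ?_⟩
  · rcases Nat.eq_zero_or_pos (mu.part i) with h0 | h0
    · omega
    -- The last box of row `i` of `μ` already forces the inequality.
    · have h1 : (i, mu.part i + i - 1) ∈ lam.diagram :=
        h (mem_diagram.2 ⟨by dsimp only; omega, by dsimp only; omega⟩)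
      have := (mem_diagram.1 h1).2
      dsimp only at this
      omega
  · have := h b.1
    rw [mem_diagram] at hb ⊢
    omega

theorem length_le_of_subset {mu lam : StrictPartition} (h : mu ⊆ lam) :
    mu.length ≤ lam.length := by
  by_contra hlt
  have h1 := part_pos (not_le.1 hlt)
  have h2 := subset_iff.1 h lam.length
  rw [part_eq_zero le_rfl] at h2
  omega

theorem size_le_of_subset {mu lam : StrictPartition} (h : mu ⊆ lam) : mu.size ≤ lam.size := by
  rw [size_eq_sum_of_le mu (length_le_of_subset h), size_eq_sum]
  exact sum_le_sum fun i _ => subset_iff.1 h i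

theorem eq_of_subset_of_size_eq {mu lam : StrictPartition} (h : mu ⊆ lam)
    (hs : mu.size = lam.size) : mu = lam := by
  refine ext_part fun i => ?_
  rcases lt_or_ge i lam.length with hi | hi
  · rw [size_eq_sum_of_le mu (length_le_of_subset h), size_eq_sum] at hs
    exact (sum_eq_sum_iff_of_le fun i _ => subset_iff.1 h i).1 hs i (mem_range.2 hi)
  · rw [part_eq_zero hi, part_eq_zero ((length_le_of_subset h).trans hi)]

/-! ### Adding a box to a strict partition. -/

/-- The strict partition with parts `f 0 > f 1 > ⋯ > f (l - 1)`. -/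
def ofFun (f : ℕ → ℕ) (l : ℕ) (hf : ∀ i j, i < j → j < l → f j < f i) (h0 : ∀ i < l, 0 < f i) :
    StrictPartition where
  parts := (List.range l).map f
  strict := by
    rw [List.pairwise_iff_getElem]
    intro i j hi hj hij
    simpa using hf i j hij (by simpa using hj)
  pos := by simpa using h0

theorem length_ofFun {f : ℕ → ℕ} {l : ℕ} {hf h0} : (ofFun f l hf h0).length = l := by
  simp [ofFun, length]

theorem part_ofFun {f : ℕ → ℕ} {l : ℕ} {hf h0} (i : ℕ) :
    (ofFun f l hf h0).part i = if i < l then f i else 0 := by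
  simp only [part, ofFun, List.getD_eq_getElem?_getD]
  split_ifs with h <;> simp [h]

/-- A box may be added at the end of row `i`. -/
def Addable (mu : StrictPartition) (i : ℕ) : Prop := ∀ k < i, mu.part i + 1 < mu.part k

/-- Below the first empty row the condition fails at `k = ℓ(μ)`, whose part is `0`. -/
theorem Addable.le_length {mu : StrictPartition} {i : ℕ} (h : mu.Addable i) : i ≤ mu.length := by
  by_contra hlt
  have := h mu.length (not_le.1 hlt)
  rw [part_eq_zero (le_refl mu.length)] at this
  omega

open Classical in
/-- The strict partition obtained by adding a box to row `i`, if this is possible. -/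
noncomputable def addBox (mu : StrictPartition) (i : ℕ) : StrictPartition :=
  if h : mu.Addable i then
    ofFun (Function.update mu.part i (mu.part i + 1)) (max mu.length (i + 1))
      (by
        intro a b hab hb
        have hi := h.le_length
        have h1 : a < mu.length := by omega
        have h2 := part_lt hab h1
        have h3 := h a
        rcases eq_or_ne b i with rfl | hbi
        · rw [Function.update_self, Function.update_of_ne hab.ne]
          exact h3 hab
        rcases eq_or_ne a i with rfl | hai
        · rw [Function.update_self, Function.update_of_ne hbi]
          omega
        · rwa [Function.update_of_ne hbi, Function.update_of_ne hai])
      (by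
        intro a ha
        simp only [Function.update_apply]
        have hi := h.le_length
        split_ifs with hai
        · omega
        · exact part_pos (by omega))
  else mu

theorem length_addBox {mu : StrictPartition} {i : ℕ} (h : mu.Addable i) :
    (mu.addBox i).length = max mu.length (i + 1) := by
  rw [addBox, dif_pos h, length_ofFun]

theorem part_addBox {mu : StrictPartition} {i : ℕ} (h : mu.Addable i) :
    (mu.addBox i).part = Function.update mu.part i (mu.part i + 1) := by
  ext k
  rw [addBox, dif_pos h, part_ofFun]
  split_ifs with hk
  · rfl
  · rw [Function.update_of_ne (by omega), part_eq_zero (by omega)]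

theorem size_addBox {mu : StrictPartition} {i : ℕ} (h : mu.Addable i) :
    (mu.addBox i).size = mu.size + 1 := by
  have hi : i ∈ range (max mu.length (i + 1)) := by simp
  rw [size_eq_sum, length_addBox h, size_eq_sum_of_le mu (le_max_left _ (i + 1)), part_addBox h,
    sum_update_of_mem hi,
    sum_eq_add_sum_sdiff_singleton_of_mem hi mu.part]
  ring

theorem addBox_subset_iff {mu lam : StrictPartition} {i : ℕ} (h : mu.Addable i) :
    mu.addBox i ⊆ lam ↔ mu ⊆ lam ∧ mu.part i < lam.part i := by
  simp only [subset_iff, part_addBox h, Function.update_apply]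
  refine ⟨fun H => ⟨fun k => ?_, ?_⟩, fun H k => ?_⟩
  · have := H k
    split_ifs at this with hk
    · subst hk; omega
    · exact this
  · have := H i
    rw [if_pos rfl] at this
    omega
  · split_ifs with hk
    · subst hk; omega
    · exact H.1 k

/-- The next box of row `i`. -/
def corner (mu : StrictPartition) (i : ℕ) : ℕ × ℕ := (i, mu.part i + i)

theorem diagram_addBox {mu : StrictPartition} {i : ℕ} (h : mu.Addable i) :
    (mu.addBox i).diagram = insert (mu.corner i) mu.diagram := by
  ext ⟨a, b⟩
  simp only [Set.mem_insert_iff, mem_diagram, part_addBox h, Function.update_apply, corner,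
    Prod.mk.injEq]
  split_ifs with hk
  · subst hk; omega
  · simp [hk]

end StrictPartition

/-! ### Tableaux as sequences of boxes, and removal of the first box. -/

/-- The box `c` is the right or lower neighbour of `b`. -/
def IsNextBox (b c : ℕ × ℕ) : Prop := c = (b.1 + 1, b.2) ∨ c = (b.1, b.2 + 1)

/-- Enumerations of a set of boxes which increase along rows and columns. -/
def standardEnumerations (D : Set (ℕ × ℕ)) (N : ℕ) : Set (Fin N → ℕ × ℕ) :=
  {p | Function.Injective p ∧ Set.range p = D ∧ ∀ i j, IsNextBox (p i) (p j) → i < j}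

theorem finite_standardEnumerations (D : Set (ℕ × ℕ)) (N : ℕ) :
    (standardEnumerations D N).Finite := by
  by_cases hD : D.Finite
  · refine (Set.Finite.pi' fun _ : Fin N => hD).subset fun p hp i => ?_
    rw [← hp.2.1]
    exact Set.mem_range_self i
  · convert Set.finite_empty
    refine Set.eq_empty_of_forall_notMem fun p hp => hD ?_
    rw [← hp.2.1]
    exact Set.finite_range p

/-- Minimality of `a` is what the order condition demands of index `0`; the conditions on the other
indices only concern `q`. -/
theorem cons_mem_standardEnumerations {D : Set (ℕ × ℕ)} {N : ℕ} {a : ℕ × ℕ}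
    {q : Fin N → ℕ × ℕ} :
    (Fin.cons a q : Fin (N + 1) → ℕ × ℕ) ∈ standardEnumerations D (N + 1) ↔
      (a ∈ D ∧ ∀ b ∈ D, ¬ IsNextBox b a) ∧ q ∈ standardEnumerations (D \ {a}) N := by
  have haa : ¬ IsNextBox a a := by
    rintro (h | h) <;> simp [Prod.ext_iff] at h
  simp only [standardEnumerations, Set.mem_ofPred_eq, Fin.cons_injective_iff, Fin.range_cons]
  constructor
  · rintro ⟨⟨ha, hq⟩, rfl, h⟩
    refine ⟨⟨Set.mem_insert _ _, ?_⟩, hq, ?_, ?_⟩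
    · rintro b (rfl | ⟨i, rfl⟩) hb
      · exact haa hb
      · exact absurd (h i.succ 0 (by simpa using hb)) (by simp)
    · rw [Set.insert_sdiff_of_mem _ (Set.mem_singleton a), Set.sdiff_singleton_eq_self ha]
    · intro i j hij
      simpa using h i.succ j.succ (by simpa using hij)
  · rintro ⟨⟨ha, hmin⟩, hq, hr, h⟩
    have hD : insert a (Set.range q) = D := by
      rw [hr, Set.insert_sdiff_singleton, Set.insert_eq_of_mem ha]
    refine ⟨⟨by rw [hr]; simp, hq⟩, hD, ?_⟩
    intro i j
    refine Fin.cases ?_ (fun i => ?_) i <;> refine Fin.cases ?_ (fun j => ?_) j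
    · intro hh; exact absurd hh haa
    · intro _; exact Fin.succ_pos j
    · intro hh
      refine absurd hh (hmin _ ?_)
      rw [← hD, Fin.cons_succ]
      exact Or.inr (Set.mem_range_self i)
    · intro hh
      simpa using h i j (by simpa using hh)

/-- Enumerations are sorted by their first box, which is a minimal one. -/
def standardEnumerationsEquiv {D : Set (ℕ × ℕ)} {N : ℕ} (A : Finset (ℕ × ℕ))
    (hA : ∀ a, a ∈ A ↔ a ∈ D ∧ ∀ b ∈ D, ¬ IsNextBox b a) :
    standardEnumerations D (N + 1) ≃ Σ a : A, standardEnumerations (D \ {a.1}) N where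
  toFun p :=
    have h := cons_mem_standardEnumerations.1
      (show Fin.cons (p.1 0) (Fin.tail p.1) ∈ _ by rw [Fin.cons_self_tail]; exact p.2)
    ⟨⟨p.1 0, (hA _).2 h.1⟩, ⟨Fin.tail p.1, h.2⟩⟩
  invFun s := ⟨Fin.cons s.1.1 s.2.1, cons_mem_standardEnumerations.2 ⟨(hA _).1 s.1.2, s.2.2⟩⟩
  left_inv p := Subtype.ext (Fin.cons_self_tail p.1)
  right_inv _ := rfl

theorem card_standardEnumerations_succ {D : Set (ℕ × ℕ)} {N : ℕ} (A : Finset (ℕ × ℕ))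
    (hA : ∀ a, a ∈ A ↔ a ∈ D ∧ ∀ b ∈ D, ¬ IsNextBox b a) :
    Nat.card (standardEnumerations D (N + 1)) =
      ∑ a ∈ A, Nat.card (standardEnumerations (D \ {a}) N) := by
  have : ∀ a : A, Finite (standardEnumerations (D \ {a.1}) N) := fun a =>
    finite_standardEnumerations _ _
  rw [Nat.card_congr (standardEnumerationsEquiv A hA), Nat.card_sigma,
    ← sum_coe_sort A fun a => Nat.card (standardEnumerations (D \ {a}) N)]

theorem card_standardEnumerations_zero :
    Nat.card (standardEnumerations ∅ 0) = 1 := by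
  have : standardEnumerations ∅ 0 = Set.univ := by
    refine Set.eq_univ_of_forall fun p => ⟨fun i => i.elim0, Set.range_eq_empty p, fun i => i.elim0⟩
  rw [this]
  simp

/-! ### The branching recurrence for the number of skew tableaux. -/

namespace StrictPartition

/-- A tableau `T` is replaced by the sequence `T⁻¹` of boxes, from which the first one can be split
off. -/
theorem dimension_eq_card (lam mu : StrictPartition) :
    lam.dimension mu =
      Nat.card (standardEnumerations (lam.diagram \ mu.diagram) (lam.size - mu.size)) := by
  refine Nat.card_eq_of_bijective (fun T => ⟨fun i => (T.1.symm i).1,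
    Subtype.val_injective.comp T.1.symm.injective, ?_, fun i j h => ?_⟩) ⟨?_, ?_⟩
  · rw [← Function.comp_def Subtype.val, Set.range_comp, T.1.symm.surjective.range_eq]
    exact (Set.image_univ).trans Subtype.range_coe
  · simpa using T.2 _ _ h
  · intro T U h
    refine Subtype.ext (Equiv.symm_bijective.injective (Equiv.ext fun i => Subtype.ext ?_))
    exact congrFun (congrArg Subtype.val h) i
  · rintro ⟨p, hp, hr, h⟩
    set e : Fin (lam.size - mu.size) ≃ ↥(lam.diagram \ mu.diagram) :=
      (Equiv.ofInjective p hp).trans (Equiv.setCongr hr) with he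
    have hpe : ∀ i, p i = (e i).1 := fun i => rfl
    refine ⟨⟨e.symm, fun b c hbc => h _ _ ?_⟩, rfl⟩
    rw [hpe, hpe, e.apply_symm_apply, e.apply_symm_apply]
    exact hbc

theorem dimension_self (lam : StrictPartition) : lam.dimension lam = 1 := by
  rw [dimension_eq_card, Set.sdiff_self, Nat.sub_self]
  exact card_standardEnumerations_zero

/-- A box of `λ/μ` without a left neighbour in `λ/μ` is the next box of its row of `μ`. If the box
above it is also not in `λ/μ`, that box lies in `μ`, because `λ` strict puts it in `λ`; this is the
condition for addability. -/
theorem minimal_box_iff {lam mu : StrictPartition} (a : ℕ × ℕ) :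
    (a ∈ lam.diagram \ mu.diagram ∧ ∀ b ∈ lam.diagram \ mu.diagram, ¬ IsNextBox b a) ↔
      ∃ i, (mu.Addable i ∧ mu.part i < lam.part i) ∧ mu.corner i = a := by
  obtain ⟨i, j⟩ := a
  simp only [Set.mem_sdiff, mem_diagram, IsNextBox, corner, Prod.forall, Prod.mk.injEq]
  constructor
  · rintro ⟨⟨⟨h1, h2⟩, h3⟩, H⟩
    have hj : mu.part i + i = j := by
      by_contra hne
      exact H i (j - 1) (by omega) (Or.inr (by omega))
    refine ⟨i, ⟨fun k hk => ?_, by omega⟩, rfl, hj⟩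
    have hi : i < lam.length := part_pos_iff.1 (by omega)
    have hlt : lam.part i < lam.part (i - 1) := part_lt (by omega) (by omega)
    have hmu : mu.part i + 1 < mu.part (i - 1) := by
      by_contra hle
      exact H (i - 1) j (by omega) (Or.inl (by omega))
    rcases (show k ≤ i - 1 by omega).eq_or_lt with rfl | hk'
    · exact hmu
    · have : i - 1 < mu.length := part_pos_iff.1 (by omega)
      exact hmu.trans (part_lt hk' (by omega))
  · rintro ⟨_, ⟨hadd, hlt⟩, rfl, rfl⟩
    refine ⟨by omega, ?_⟩
    rintro a b ⟨h1, h2⟩ (⟨h3, h4⟩ | ⟨h3, h4⟩)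
    · have := hadd a (by omega)
      omega
    · subst h3
      omega

open Classical in
theorem dimension_eq_sum {lam mu : StrictPartition} (hs : mu.size < lam.size) :
    lam.dimension mu = ∑ i ∈ range lam.length with mu.Addable i ∧ mu.part i < lam.part i,
      lam.dimension (mu.addBox i) := by
  obtain ⟨N, hN⟩ : ∃ N, lam.size - mu.size = N + 1 := ⟨lam.size - mu.size - 1, by omega⟩
  have hd : ∀ (s t : Set (ℕ × ℕ)) (a : ℕ × ℕ), s \ insert a t = (s \ t) \ {a} := by
    intro s t a
    ext b
    simp only [Set.mem_sdiff, Set.mem_insert_iff, Set.mem_singleton_iff]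
    tauto
  rw [dimension_eq_card, hN, card_standardEnumerations_succ
    (({i ∈ range lam.length | mu.Addable i ∧ mu.part i < lam.part i}).image mu.corner),
    sum_image]
  · refine sum_congr rfl fun i hi => ?_
    have hadd := (mem_filter.1 hi).2.1
    rw [dimension_eq_card, diagram_addBox hadd, size_addBox hadd, hd,
      show lam.size - (mu.size + 1) = N by omega]
  · intro i _ j _ hij
    exact (Prod.ext_iff.1 hij).1
  · intro a
    rw [minimal_box_iff]
    simp only [mem_image, mem_filter, mem_range]
    refine exists_congr fun i => ⟨fun H => ⟨H.1.2, H.2⟩, fun H => ⟨⟨part_pos_iff.1 ?_, H.1⟩, H.2⟩⟩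
    omega

end StrictPartition

/-! ### Falling powers and an interpolation identity. -/

theorem sum_range_eq_sum_fin_filter {M : Type*} [AddCommMonoid M] {l n : ℕ} (h : l ≤ n)
    (f : ℕ → M) : ∑ i ∈ range l, f i = ∑ i : Fin n with i.val < l, f i := by
  rw [sum_filter, Fin.sum_univ_eq_sum_range (fun i => if i < l then f i else 0), ← sum_filter]
  refine sum_congr ?_ fun _ _ => rfl
  ext i
  simp only [mem_range, mem_filter]
  omega

theorem fallingPow_succ {R : Type*} [CommRing R] (x : R) (k : ℕ) :
    fallingPow x (k + 1) = fallingPow x k * (x - k) := prod_range_succ _ _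

theorem fallingPow_natCast {R : Type*} [CommRing R] (a k : ℕ) :
    fallingPow (a : R) k = (a.descFactorial k : R) := by
  induction k with
  | zero => simp [fallingPow]
  | succ k ih =>
    rw [fallingPow_succ, ih, Nat.descFactorial_succ, Nat.cast_mul, mul_comm]
    rcases le_or_gt k a with h | h
    · rw [Nat.cast_sub h]
    · simp [Nat.descFactorial_eq_zero_iff_lt.2 h]

/-- With `A = ∏ (X + y_j)` and `B = ∏ (X - y_j)`, the difference `A - B` has degree below `#s` and
takes the value `2 y_p ∏_{j ≠ p} (y_p + y_j)` at `y_p`. Its coefficient of degree `#s - 1` is `2 ∑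
y_j` directly, and twice the left side by Lagrange interpolation. -/
theorem sum_mul_prod_add_div_sub {ι K : Type*} [DecidableEq ι] [Field K] [CharZero K]
    (s : Finset ι) (y : ι → K) (hy : Set.InjOn y s) :
    ∑ p ∈ s, y p * ∏ j ∈ s.erase p, (y p + y j) / (y p - y j) = ∑ p ∈ s, y p := by
  open Polynomial in
  rcases s.eq_empty_or_nonempty with rfl | hs
  · simp
  set A : K[X] := ∏ j ∈ s, (X - C (-y j)) with hA
  set B : K[X] := ∏ j ∈ s, (X - C (y j)) with hB
  have hAm : A.Monic := monic_prod_of_monic _ _ fun j _ => monic_X_sub_C _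
  have hBm : B.Monic := monic_prod_of_monic _ _ fun j _ => monic_X_sub_C _
  have hAd : A.degree = #s := by
    rw [hA, degree_prod]; simp only [degree_X_sub_C]; simp
  have hBd : B.degree = #s := by
    rw [hB, degree_prod]; simp only [degree_X_sub_C]; simp
  have hdeg : (A - B).degree < #s := by
    rw [← hAd]
    exact degree_sub_lt_left (hAd.trans hBd.symm) hAm.ne_zero
      (hAm.leadingCoeff.trans hBm.leadingCoeff.symm)
  have h := Lagrange.coeff_eq_sum hy hdeg
  rw [coeff_sub, hA, hB, prod_X_sub_C_coeff_card_pred s _ hs.card_pos,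
    prod_X_sub_C_coeff_card_pred s _ hs.card_pos, sum_neg_distrib] at h
  have h2 : ∀ p ∈ s, (A - B).eval (y p) / ∏ j ∈ s.erase p, (y p - y j) =
      2 * (y p * ∏ j ∈ s.erase p, (y p + y j) / (y p - y j)) := by
    intro p hp
    have hB0 : B.eval (y p) = 0 := by
      rw [hB, eval_prod]
      exact prod_eq_zero hp (by simp)
    rw [eval_sub, hB0, sub_zero, hA, eval_prod, ← mul_prod_erase s _ hp, prod_div_distrib]
    simp only [eval_sub, eval_X, eval_C, sub_neg_eq_add]
    ring
  rw [sum_congr rfl h2, ← mul_sum] at h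
  have h3 : (2 : K) ≠ 0 := two_ne_zero
  apply mul_left_cancel₀ h3
  rw [← h]
  ring

theorem sum_perm_comp_mul_right {M : Type*} [AddCommMonoid M] {n : ℕ} {X : Type*} (x : Fin n → X)
    (s : Equiv.Perm (Fin n)) (F : (Fin n → X) → M) :
    ∑ w : Equiv.Perm (Fin n), F (fun i => x (w (s i))) =
      ∑ w : Equiv.Perm (Fin n), F (fun i => x (w i)) :=
  Equiv.sum_comp (Equiv.mulRight s) fun w : Equiv.Perm (Fin n) => F (fun i => x (w i))

/-! ### Symmetrized sums for arbitrary exponents, and the Pieri rule. -/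

section RowSum

variable {n : ℕ} {K : Type*} [Field K]

/-- The summand of the factorial Schur P-function, for an arbitrary sequence `m` of exponents. -/
def rowSummand (m : ℕ → ℕ) (l : ℕ) (y : Fin n → K) : K :=
  (∏ i : Fin n with i.val < l, fallingPow (y i) (m i)) *
    ∏ i : Fin n with i.val < l, ∏ j ∈ Ioi i, (y i + y j) / (y i - y j)

/-- The normalized symmetrization of `rowSummand`. -/
def rowSum (m : ℕ → ℕ) (l : ℕ) (x : Fin n → K) : K :=
  (((n - l).factorial : ℕ) : K)⁻¹ * ∑ w : Equiv.Perm (Fin n), rowSummand m l fun i => x (w i)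

theorem prod_ratio_eq (l : ℕ) (y : Fin n → K) :
    ∏ i : Fin n with i.val < l, ∏ j ∈ Ioi i, (y i + y j) / (y i - y j) =
      ∏ p : Fin n × Fin n with p.1.val < l ∧ p.1 < p.2, (y p.1 + y p.2) / (y p.1 - y p.2) := by
  rw [prod_filter, prod_filter, Fintype.prod_prod_type]
  refine prod_congr rfl fun i _ => ?_
  split_ifs with h
  · simp only [h, true_and]
    rw [← prod_filter]
    refine prod_congr ?_ fun _ _ => rfl
    ext j
    simp
  · simp [h]

theorem prod_fallingPow_comp (m : ℕ → ℕ) (l : ℕ) (y : Fin n → K) (s : Equiv.Perm (Fin n))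
    (hs : ∀ i, (s i).val < l ↔ i.val < l) (hm : ∀ i, i.val < l → m (s i) = m i) :
    ∏ i : Fin n with i.val < l, fallingPow (y (s i)) (m i) =
      ∏ i : Fin n with i.val < l, fallingPow (y i) (m i) := by
  refine prod_equiv s (fun i => by simp [hs]) fun i hi => ?_
  rw [hm i (mem_filter.1 hi).2]

/-- The variables from position `l` on enter only as second members `j` of pairs `i < l ≤ j`, so the
swap merely permutes factors. -/
theorem rowSummand_swap (m : ℕ → ℕ) {l : ℕ} (y : Fin n → K) {a b : Fin n} (ha : l ≤ a)
    (hb : l ≤ b) : rowSummand m l (fun i => y (Equiv.swap a b i)) = rowSummand m l y := by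
  have hfix : ∀ i : Fin n, i.val < l → Equiv.swap a b i = i := fun i hi =>
    Equiv.swap_apply_of_ne_of_ne (by rintro rfl; omega) (by rintro rfl; omega)
  have hlt : ∀ i : Fin n, (Equiv.swap a b i).val < l ↔ i.val < l := by
    intro i
    rw [Equiv.swap_apply_def]
    split_ifs with h1 h2
    · subst h1; omega
    · subst h2; omega
    · rfl
  rw [rowSummand, rowSummand,
    prod_fallingPow_comp m l y _ hlt fun i hi => by rw [hfix i hi]]
  congr 1
  refine prod_congr rfl fun i hi => ?_
  have hil := (mem_filter.1 hi).2
  rw [hfix i hil]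
  refine prod_equiv (Equiv.swap a b) (fun j => ?_) fun j _ => rfl
  simp only [mem_Ioi, Fin.lt_def]
  rcases lt_or_ge j.val l with hj | hj
  · rw [hfix j hj]
  · have := (hlt j).not.2 (by omega)
    omega

/-- For adjacent positions the pair `(a, b)` is the only one whose order is reversed. Its factor
changes sign and the other factors are permuted. -/
theorem rowSummand_swap_adjacent (m : ℕ → ℕ) {l : ℕ} (y : Fin n → K) {a b : Fin n}
    (hab : b.val = a.val + 1) (hb : b.val < l) (hm : m a = m b) :
    rowSummand m l (fun i => y (Equiv.swap a b i)) = -rowSummand m l y := by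
  have hne : a ≠ b := by rintro rfl; omega
  have hlt : ∀ i : Fin n, (Equiv.swap a b i).val < l ↔ i.val < l := by
    intro i
    rw [Equiv.swap_apply_def]
    split_ifs with h1 h2
    · subst h1; omega
    · subst h2; omega
    · rfl
  rw [rowSummand, rowSummand, prod_fallingPow_comp m l y _ hlt ?_]
  · rw [prod_ratio_eq, prod_ratio_eq l y, ← mul_neg]
    congr 1
    have hmem : (a, b) ∈ ({p : Fin n × Fin n | p.1.val < l ∧ p.1 < p.2} : Finset _) := by
      simp only [mem_filter, mem_univ, true_and, Fin.lt_def]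
      omega
    rw [← mul_prod_erase _ _ hmem, ← mul_prod_erase _ _ hmem, ← neg_mul]
    congr 1
    · dsimp only
      rw [Equiv.swap_apply_left, Equiv.swap_apply_right, ← neg_sub (y a) (y b), div_neg, add_comm]
    · refine prod_equiv ((Equiv.swap a b).prodCongr (Equiv.swap a b)) (fun p => ?_) fun p _ => rfl
      obtain ⟨i, j⟩ := p
      simp only [mem_erase, mem_filter, mem_univ, true_and, Equiv.prodCongr_apply, Prod.map_apply,
        ne_eq, Prod.mk.injEq, Fin.lt_def, Fin.ext_iff, Equiv.swap_apply_def]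
      split_ifs <;> omega
  · intro i _
    rw [Equiv.swap_apply_def]
    split_ifs with h1 h2
    · rw [h1, hm]
    · rw [h2, hm]
    · rfl

/-- This removes from the Pieri rule the rows to which no box can be added: there the increment
makes two consecutive exponents equal, and an antisymmetric summand symmetrizes to `0`. -/
theorem rowSum_eq_zero [CharZero K] (m : ℕ → ℕ) {l i : ℕ} (x : Fin n → K) (hl : l ≤ n)
    (hi : i + 1 < l) (hm : m i = m (i + 1)) : rowSum m l x = 0 := by
  have h1 := sum_perm_comp_mul_right x
    (Equiv.swap (⟨i, by omega⟩ : Fin n) ⟨i + 1, by omega⟩) (rowSummand m l)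
  have h2 : ∀ w : Equiv.Perm (Fin n), rowSummand m l (fun k => x (w
      (Equiv.swap (⟨i, by omega⟩ : Fin n) ⟨i + 1, by omega⟩ k))) =
      -rowSummand m l (fun k => x (w k)) := fun w =>
    rowSummand_swap_adjacent m (fun k => x (w k)) rfl hi hm
  rw [sum_congr rfl fun w _ => h2 w, sum_neg_distrib, neg_eq_self] at h1
  rw [rowSum, h1, mul_zero]

theorem rowSum_zero [CharZero K] (m : ℕ → ℕ) (x : Fin n → K) :
    rowSum m 0 x = 1 := by
  have h : ∀ w : Equiv.Perm (Fin n), rowSummand m 0 (fun i => x (w i)) = 1 := by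
    intro w
    simp [rowSummand]
  rw [rowSum, sum_congr rfl fun w _ => h w, sum_const, card_univ, Fintype.card_perm,
    Fintype.card_fin, nsmul_eq_mul, mul_one, Nat.sub_zero,
    inv_mul_cancel₀ (Nat.cast_ne_zero.2 (Nat.factorial_ne_zero _))]

theorem rowSummand_update (m : ℕ → ℕ) {l : ℕ} (y : Fin n → K) (i : Fin n) (hi : i.val < l) :
    rowSummand (Function.update m i (m i + 1)) l y = (y i - m i) * rowSummand m l y := by
  rw [rowSummand, rowSummand, ← mul_assoc]
  congr 1
  have hmem : i ∈ ({k : Fin n | k.val < l} : Finset _) := by simpa using hi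
  rw [← mul_prod_erase _ _ hmem, ← mul_prod_erase _ _ hmem, Function.update_self, fallingPow_succ]
  rw [prod_congr rfl (g := fun k : Fin n => fallingPow (y k) (m k))]
  · ring
  · intro k hk
    rw [Function.update_of_ne]
    exact fun h => (mem_erase.1 hk).1 (Fin.ext h)

theorem rowSummand_new_row (m : ℕ → ℕ) (y : Fin n → K) (a : Fin n) (hm : m a = 0) :
    rowSummand (Function.update m a (m a + 1)) (a + 1) y = rowSummand m a y *
      (y a * ∏ j ∈ ({j | a.val ≤ j.val} : Finset (Fin n)).erase a, (y a + y j) / (y a - y j)) := by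
  have h1 : ({k : Fin n | k.val < a.val + 1} : Finset _) =
      insert a ({k : Fin n | k.val < a.val} : Finset _) := by
    ext k
    simp only [mem_filter, mem_univ, true_and, mem_insert, Fin.ext_iff]
    omega
  have h2 : ({j | a.val ≤ j.val} : Finset (Fin n)).erase a = Ioi a := by
    ext k
    simp only [mem_filter, mem_univ, true_and, mem_erase, ne_eq, mem_Ioi, Fin.ext_iff, Fin.lt_def]
    omega
  rw [rowSummand, rowSummand, h1, h2, prod_insert (by simp), prod_insert (by simp),
    Function.update_self, hm, fallingPow_succ]
  rw [prod_congr rfl (g := fun k : Fin n => fallingPow (y k) (m k))]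
  · simp only [fallingPow, prod_range_zero, Nat.cast_zero, sub_zero]
    ring
  · intro k hk
    have := (mem_filter.1 hk).2
    rw [Function.update_of_ne (by omega)]

/-- Opening row `a` multiplies the summand by `Q a`. As the old summand is symmetric in the
positions from `a` on, `Q a` may be averaged over all `Q p` with `p ≥ a`, and
`sum_mul_prod_add_div_sub` evaluates their sum. -/
theorem rowSum_new_row [CharZero K] (m : ℕ → ℕ) (x : Fin n → K) (hx : Function.Injective x)
    (a : Fin n) (hm : m a = 0) :
    rowSum (Function.update m a (m a + 1)) (a + 1) x =
      (((n - a).factorial : ℕ) : K)⁻¹ * ∑ w : Equiv.Perm (Fin n),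
        rowSummand m a (fun i => x (w i)) * ∑ p : Fin n with a.val ≤ p.val, x (w p) := by
  set s : Finset (Fin n) := {j | a.val ≤ j.val} with hs
  set Q : Fin n → (Fin n → K) → K := fun p y =>
    y p * ∏ j ∈ s.erase p, (y p + y j) / (y p - y j) with hQ
  have hswap : ∀ p ∈ s, ∑ w : Equiv.Perm (Fin n),
      rowSummand m a (fun i => x (w i)) * Q a (fun i => x (w i)) =
      ∑ w : Equiv.Perm (Fin n),
        rowSummand m a (fun i => x (w i)) * Q p (fun i => x (w i)) := by
    intro p hp
    have hpa : a.val ≤ p.val := (mem_filter.1 hp).2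
    rw [← sum_perm_comp_mul_right x (Equiv.swap a p) fun y => rowSummand m a y * Q a y]
    refine sum_congr rfl fun w _ => ?_
    rw [rowSummand_swap m (fun i => x (w i)) le_rfl hpa]
    congr 1
    simp only [hQ, Equiv.swap_apply_left]
    congr 1
    refine prod_equiv (Equiv.swap a p) (fun j => ?_) fun j _ => rfl
    simp only [hs, mem_erase, mem_filter, mem_univ, true_and, Equiv.swap_apply_def, ne_eq,
      Fin.ext_iff]
    split_ifs <;> omega
  have hcard : #s = n - a := by
    rw [hs, show ({j | a.val ≤ j.val} : Finset (Fin n)) = Ici a from ?_]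
    · exact Fin.card_Ici a
    · ext k
      simp only [mem_filter, mem_univ, true_and, mem_Ici, Fin.le_def]
  have hsum : ((n - a : ℕ) : K) * ∑ w : Equiv.Perm (Fin n),
      rowSummand m a (fun i => x (w i)) * Q a (fun i => x (w i)) =
      ∑ w : Equiv.Perm (Fin n), rowSummand m a (fun i => x (w i)) * ∑ p ∈ s, x (w p) := by
    rw [← hcard, ← nsmul_eq_mul, ← sum_const, sum_congr rfl hswap, sum_comm]
    refine sum_congr rfl fun w _ => ?_
    rw [← mul_sum, sum_mul_prod_add_div_sub s (fun i => x (w i)) (hx.comp w.injective).injOn]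
  -- The `n - a` terms of the average account for the passage from `1/(n-a-1)!` to `1/(n-a)!`.
  have hna : n - a.val = (n - (a.val + 1)) + 1 := by omega
  have hna0 : ((n - a.val : ℕ) : K) ≠ 0 := Nat.cast_ne_zero.2 (by omega)
  rw [← hsum, rowSum, sum_congr rfl fun w _ => rowSummand_new_row m (fun i => x (w i)) a hm,
    ← mul_assoc]
  congr 1
  rw [hna, Nat.factorial_succ, ← hna, Nat.cast_mul, mul_inv, mul_right_comm,
    inv_mul_cancel₀ hna0, one_mul]

/-- Raising the exponent `m i` multiplies each summand by `x_{w(i)} - m i`. -/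
theorem sum_rowSum_update_of_lt [CharZero K] (m : ℕ → ℕ) {l : ℕ} (x : Fin n → K) (hl : l ≤ n) :
    ∑ i ∈ range l, rowSum (Function.update m i (m i + 1)) l x =
      (((n - l).factorial : ℕ) : K)⁻¹ * ∑ w : Equiv.Perm (Fin n),
        rowSummand m l (fun i => x (w i)) *
          (∑ p : Fin n with p.val < l, x (w p) - ∑ i ∈ range l, (m i : K)) := by
  rw [sum_range_eq_sum_fin_filter hl, sum_range_eq_sum_fin_filter hl]
  simp only [rowSum]
  rw [← mul_sum, sum_comm]
  congr 1
  refine sum_congr rfl fun w _ => ?_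
  rw [← sum_sub_distrib, mul_sum]
  refine sum_congr rfl fun i hi => ?_
  rw [rowSummand_update m _ i (mem_filter.1 hi).2, mul_comm]

/-- The Pieri rule for multiplication by the sum of the variables. -/
theorem sum_rowSum_update [CharZero K] (m : ℕ → ℕ) {l : ℕ} (x : Fin n → K)
    (hx : Function.Injective x) (hl : l ≤ n) (hm : m l = 0) :
    ∑ i ∈ range n with i ≤ l, rowSum (Function.update m i (m i + 1)) (max l (i + 1)) x =
      (∑ i, x i - ∑ i ∈ range l, (m i : K)) * rowSum m l x := by
  have hmax : ∑ i ∈ range l, rowSum (Function.update m i (m i + 1)) (max l (i + 1)) x =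
      ∑ i ∈ range l, rowSum (Function.update m i (m i + 1)) l x :=
    sum_congr rfl fun i hi => by rw [max_eq_left (Nat.succ_le_of_lt (mem_range.1 hi))]
  have hperm : ∀ w : Equiv.Perm (Fin n), ∑ i, x i = ∑ i, x (w i) := fun w =>
    (Equiv.sum_comp w x).symm
  -- If `l = n` there is no room for a new row, and the old rows already see all variables;
  -- otherwise the new row supplies the variables from position `l` on.
  rcases hl.eq_or_lt with rfl | hlt
  · rw [filter_true_of_mem fun i hi => (mem_range.1 hi).le, hmax, sum_rowSum_update_of_lt m x le_rfl,
      rowSum, mul_left_comm]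
    congr 1
    rw [mul_sum]
    refine sum_congr rfl fun w _ => ?_
    rw [hperm w, filter_true_of_mem fun i _ => i.2, mul_comm]
  · have hf : ({i ∈ range n | i ≤ l} : Finset ℕ) = range (l + 1) := by
      ext i
      simp only [mem_filter, mem_range]
      omega
    rw [hf, sum_range_succ, hmax, sum_rowSum_update_of_lt m x hl, max_eq_right (Nat.le_succ l)]
    have hnew := rowSum_new_row m x hx ⟨l, hlt⟩ hm
    dsimp only at hnew
    rw [hnew, ← mul_add, ← sum_add_distrib, rowSum, mul_left_comm]
    congr 1
    rw [mul_sum]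
    refine sum_congr rfl fun w _ => ?_
    have hsplit := sum_filter_add_sum_filter_not (univ : Finset (Fin n)) (fun p => p.val < l)
      fun p => x (w p)
    simp only [not_lt] at hsplit
    rw [hperm w, ← hsplit]
    ring

end RowSum

/-! ### Values of the polynomial at points with distinct coordinates. -/

theorem factorialSum_mul_vandermonde (mu : StrictPartition) {n : ℕ} {K : Type*} [Field K]
    [CharZero K] (x : Fin n → K) (hx : Function.Injective x) :
    (((n - mu.length).factorial : ℕ) : K) * factorialSum mu x *
        (∏ i : Fin n, ∏ j ∈ Ioi i, (x j - x i)) =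
      ∑ w : Equiv.Perm (Fin n), ((Equiv.Perm.sign w : ℤ) : K) *
        factorialNumerator mu (fun k => x (w k)) := by
  rw [factorialSum, mul_inv_cancel_left₀ (Nat.cast_ne_zero.2 (Nat.factorial_ne_zero _)), sum_mul]
  refine sum_congr rfl fun w _ => ?_
  rw [← factorialSummand_mul mu (fun i => x (w i)) (hx.comp w.injective), vandermonde_perm x w]
  have hs : (((Equiv.Perm.sign w : ℤ) : K)) * ((Equiv.Perm.sign w : ℤ) : K) = 1 := by
    rw [← Int.cast_mul, ← Units.val_mul, Int.units_mul_self]; simp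
  linear_combination (-(factorialSummand mu fun i => x (w i)) *
    ∏ i : Fin n, ∏ j ∈ Ioi i, (x j - x i)) * hs

/-- Evaluation does not extend to the fraction field, so denominators are cleared first: multiplied
by the Vandermonde product, the defining identity holds among polynomials. It is evaluated there,
and the Vandermonde value is nonzero at distinct coordinates. -/
theorem eval_factorialSchurP (mu : StrictPartition) {n : ℕ} (hn : mu.length ≤ n)
    (x : Fin n → ℚ) (hx : Function.Injective x) :
    MvPolynomial.eval x (factorialSchurP mu n) = factorialSum mu x := by
  rw [factorialSchurP, if_pos hn]
  have hp := Classical.choose_spec (exists_factorialPolynomial mu n)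
  set p := Classical.choose (exists_factorialPolynomial mu n)
  have hinj := IsFractionRing.injective (MvPolynomial (Fin n) ℚ)
    (FractionRing (MvPolynomial (Fin n) ℚ))
  have h := factorialSum_mul_vandermonde mu (fun i : Fin n =>
    algebraMap (MvPolynomial (Fin n) ℚ) (FractionRing (MvPolynomial (Fin n) ℚ))
      (MvPolynomial.X i)) (hinj.comp (MvPolynomial.X_injective (R := ℚ)))
  rw [← factorialRational, ← hp] at h
  simp only [← map_factorialNumerator, ← map_sub, ← map_prod, ← map_natCast
    (algebraMap (MvPolynomial (Fin n) ℚ) (FractionRing (MvPolynomial (Fin n) ℚ))), ← map_mul,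
    ← map_intCast (algebraMap (MvPolynomial (Fin n) ℚ) (FractionRing (MvPolynomial (Fin n) ℚ))),
    ← map_sum] at h
  have h2 := congrArg (MvPolynomial.eval x) (hinj h)
  simp only [map_mul, map_sum, map_prod, map_sub, map_natCast, map_intCast,
    map_factorialNumerator, MvPolynomial.eval_X] at h2
  rw [← factorialSum_mul_vandermonde mu x hx] at h2
  have hV : (∏ i : Fin n, ∏ j ∈ Ioi i, (x j - x i)) ≠ 0 :=
    prod_ne_zero_iff.2 fun i _ => prod_ne_zero_iff.2 fun j hj =>
      sub_ne_zero.2 fun e => (mem_Ioi.1 hj).ne' (hx e)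
  exact mul_left_cancel₀ (Nat.cast_ne_zero.2 (Nat.factorial_ne_zero _))
    (mul_right_cancel₀ hV h2)

/-! ### Values at `λ` and the induction. -/

namespace StrictPartition

/-- The parts of a strict partition as rational numbers. -/
def ratParts (lam : StrictPartition) (i : Fin lam.length) : ℚ := lam.part i

theorem part_strictAnti (lam : StrictPartition) :
    StrictAnti fun i : Fin lam.length => lam.part i := fun i _ hij => part_lt hij i.2

theorem ratParts_injective (lam : StrictPartition) : Function.Injective lam.ratParts :=
  fun _ _ h => lam.part_strictAnti.injective (Nat.cast_injective h)

theorem sum_ratParts (lam : StrictPartition) : ∑ i, lam.ratParts i = lam.size := by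
  rw [size_eq_sum, ← Fin.sum_univ_eq_sum_range, Nat.cast_sum]
  rfl

/-- Nonvanishing falling powers force `μ_i ≤ λ_{w(i)}` for all `i`, and the two sides have the same
sum. -/
theorem part_eq_of_rowSummand_ne_zero {lam mu : StrictPartition} (hl : mu.length ≤ lam.length)
    (hs : mu.size = lam.size) (w : Equiv.Perm (Fin lam.length))
    (h : rowSummand mu.part mu.length (fun i => lam.ratParts (w i)) ≠ 0) (i : Fin lam.length) :
    mu.part i = lam.part (w i) := by
  have hle : ∀ i : Fin lam.length, mu.part i ≤ lam.part (w i) := by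
    intro i
    rcases lt_or_ge i.val mu.length with hi | hi
    · have h1 : fallingPow (lam.part (w i) : ℚ) (mu.part i) ≠ 0 :=
        prod_ne_zero_iff.1 (left_ne_zero_of_mul h) i (by simpa using hi)
      rw [fallingPow_natCast, Nat.cast_ne_zero, ne_eq,
        Nat.descFactorial_eq_zero_iff_lt, not_lt] at h1
      exact h1
    · rw [part_eq_zero hi]
      exact Nat.zero_le _
  refine (sum_eq_sum_iff_of_le fun i _ => hle i).1 ?_ i (mem_univ i)
  rw [Equiv.sum_comp w fun i : Fin lam.length => lam.part i, Fin.sum_univ_eq_sum_range,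
    Fin.sum_univ_eq_sum_range, ← size_eq_sum_of_le mu hl, ← size_eq_sum, hs]

theorem eq_one_of_rowSummand_ne_zero {lam mu : StrictPartition} (hl : mu.length ≤ lam.length)
    (hs : mu.size = lam.size) (w : Equiv.Perm (Fin lam.length))
    (h : rowSummand mu.part mu.length (fun i => lam.ratParts (w i)) ≠ 0) : w = 1 := by
  have hp := part_eq_of_rowSummand_ne_zero hl hs w h
  -- Both sequences of parts decrease strictly, so `w` preserves the order.
  have hw : StrictMono w := by
    intro i j hij
    rw [← lam.part_strictAnti.lt_iff_gt]
    rw [← hp, ← hp]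
    refine part_lt hij (part_pos_iff.1 ?_)
    rw [hp]
    exact part_pos (w i).2
  refine Equiv.ext fun i => congrFun ((StrictMono.range_inj hw strictMono_id).1 ?_) i
  rw [w.surjective.range_eq, Set.range_id]

theorem rowSum_eq_zero_of_ne {lam mu : StrictPartition} (hl : mu.length ≤ lam.length)
    (hs : mu.size = lam.size) (hne : mu ≠ lam) :
    rowSum mu.part mu.length lam.ratParts = 0 := by
  rw [rowSum, sum_eq_zero, mul_zero]
  intro w _
  by_contra h
  have hp := part_eq_of_rowSummand_ne_zero hl hs w h
  rw [eq_one_of_rowSummand_ne_zero hl hs w h] at hp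
  refine hne (ext_part fun i => ?_)
  rcases lt_or_ge i lam.length with hi | hi
  · exact hp ⟨i, hi⟩
  · rw [part_eq_zero hi, part_eq_zero (hl.trans hi)]

/-- The quotient `g_{λ/∅} / |λ|!`. -/
def normalizedDimension (lam : StrictPartition) : ℚ :=
  (∏ k : Fin lam.length, ((lam.part k).factorial : ℚ))⁻¹ *
    ∏ i : Fin lam.length, ∏ j ∈ Ioi i,
      ((lam.part i : ℚ) - lam.part j) / ((lam.part i : ℚ) + lam.part j)

theorem normalizedDimension_mul_rowSum (lam : StrictPartition) :
    lam.normalizedDimension * rowSum lam.part lam.length lam.ratParts = 1 := by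
  have h1 : rowSum lam.part lam.length lam.ratParts =
      (∏ k : Fin lam.length, ((lam.part k).factorial : ℚ)) *
        ∏ i : Fin lam.length, ∏ j ∈ Ioi i,
          ((lam.part i : ℚ) + lam.part j) / ((lam.part i : ℚ) - lam.part j) := by
    rw [rowSum, Fintype.sum_eq_single 1, Nat.sub_self, Nat.factorial_zero, Nat.cast_one, inv_one,
      one_mul, rowSummand, filter_true_of_mem fun i _ => i.2]
    · congr 1
      refine prod_congr rfl fun i _ => ?_
      rw [Equiv.Perm.one_apply, ratParts, fallingPow_natCast, Nat.descFactorial_self]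
    · intro w hw
      by_contra h
      exact hw (eq_one_of_rowSummand_ne_zero le_rfl rfl w h)
  have h2 : (∏ i : Fin lam.length, ∏ j ∈ Ioi i,
        ((lam.part i : ℚ) - lam.part j) / ((lam.part i : ℚ) + lam.part j)) *
      ∏ i : Fin lam.length, ∏ j ∈ Ioi i,
        ((lam.part i : ℚ) + lam.part j) / ((lam.part i : ℚ) - lam.part j) = 1 := by
    rw [← prod_mul_distrib]
    refine prod_eq_one fun i _ => ?_
    rw [← prod_mul_distrib]
    refine prod_eq_one fun j hj => ?_
    have h3 : (lam.part i : ℚ) - lam.part j ≠ 0 :=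
      sub_ne_zero.2 fun e => (mem_Ioi.1 hj).ne (lam.ratParts_injective e)
    have h4 : (lam.part i : ℚ) + lam.part j ≠ 0 := by
      have := part_pos i.2
      positivity
    field_simp
  have h5 : (∏ k : Fin lam.length, ((lam.part k).factorial : ℚ)) ≠ 0 :=
    prod_ne_zero_iff.2 fun k _ => Nat.cast_ne_zero.2 (Nat.factorial_ne_zero _)
  rw [h1, normalizedDimension, mul_mul_mul_comm, h2, inv_mul_cancel₀ h5, one_mul]

theorem rowSum_update_eq_zero {n : ℕ} {mu : StrictPartition} {i : ℕ} (hi : i ≤ mu.length)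
    (hin : i < n) (hl : mu.length ≤ n) (h : ¬ mu.Addable i) (x : Fin n → ℚ) :
    rowSum (Function.update mu.part i (mu.part i + 1)) (max mu.length (i + 1)) x = 0 := by
  simp only [Addable, not_forall, not_lt] at h
  obtain ⟨k, hk, hle⟩ := h
  have h1 : mu.part i < mu.part k := part_lt hk (by omega)
  -- If `k + 1 < i`, two strict descents give `μ_k ≥ μ_i + 2`, so the obstruction is the row
  -- directly above.
  have h2 : k + 1 = i := by
    by_contra hne
    have h3 : mu.part i < mu.part (k + 1) := part_lt (by omega) (by omega)
    have h4 : mu.part (k + 1) < mu.part k := part_lt (by omega) (by omega)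
    omega
  refine rowSum_eq_zero _ x (max_le hl hin) (i := k) (by omega) ?_
  rw [h2, Function.update_self, Function.update_of_ne hk.ne]
  omega

-- Partitions not contained in `λ` must be included: the Pieri rule also adds boxes that leave `λ`,
-- and the induction has to know that these terms vanish.
open Classical in
theorem dimension_eq_rowSum (lam : StrictPartition) (N : ℕ) :
    ∀ mu : StrictPartition, mu.length ≤ lam.length → mu.size + N = lam.size →
      (if mu ⊆ lam then (lam.dimension mu : ℚ) else 0) =
        N.factorial * lam.normalizedDimension * rowSum mu.part mu.length lam.ratParts := by
  induction N with
  | zero =>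
    intro mu hl hs
    rcases eq_or_ne mu lam with rfl | hne
    · rw [if_pos (subset_iff.2 fun _ => le_rfl), dimension_self, mul_assoc,
        normalizedDimension_mul_rowSum]
      simp
    · rw [if_neg fun h => hne (eq_of_subset_of_size_eq h hs), rowSum_eq_zero_of_ne hl hs hne,
        mul_zero]
  | succ N ih =>
    intro mu hl hs
    have hpieri := sum_rowSum_update mu.part lam.ratParts lam.ratParts_injective hl
      (part_eq_zero le_rfl)
    rw [sum_ratParts, ← Nat.cast_sum, ← size_eq_sum, ← hs, Nat.cast_add, add_sub_cancel_left]
      at hpieri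
    rw [Nat.factorial_succ, Nat.cast_mul, mul_comm ((N + 1 : ℕ) : ℚ), mul_assoc, mul_assoc,
      mul_left_comm ((N + 1 : ℕ) : ℚ), ← mul_assoc, ← hpieri, mul_sum]
    have hterm : ∀ i ∈ range lam.length, (if i ≤ mu.length then
        N.factorial * lam.normalizedDimension * rowSum
          (Function.update mu.part i (mu.part i + 1)) (max mu.length (i + 1)) lam.ratParts else 0) =
        if mu ⊆ lam ∧ mu.Addable i ∧ mu.part i < lam.part i then
          (lam.dimension (mu.addBox i) : ℚ) else 0 := by
      intro i hi
      have hin := mem_range.1 hi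
      by_cases hadd : mu.Addable i
      · rw [if_pos hadd.le_length, ← part_addBox hadd, ← length_addBox hadd,
          ← ih _ (by rw [length_addBox hadd]; exact max_le hl hin)
            (by rw [size_addBox hadd, ← hs]; ring)]
        simp only [addBox_subset_iff hadd, hadd, true_and]
      · rw [if_neg (c := mu ⊆ lam ∧ _) fun h => hadd h.2.1]
        split_ifs with hil
        · rw [rowSum_update_eq_zero hil hin hl hadd, mul_zero]
        · rfl
    rw [sum_filter, sum_congr rfl hterm]
    split_ifs with hsub
    · rw [dimension_eq_sum (by omega), sum_filter, Nat.cast_sum]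
      refine sum_congr rfl fun i _ => ?_
      simp only [hsub, true_and]
      split_ifs <;> simp
    -- If `μ ⊄ λ`, no diagram obtained by adding a box lies in `λ`, so every term is zero.
    · simp [hsub]

end StrictPartition

open StrictPartition in
theorem mainTheorem6 (lam mu : StrictPartition) (h : mu ⊆ lam) :
    (lam.dimension mu : ℚ) =
        (lam.dimension StrictPartition.empty : ℚ) *
          (MvPolynomial.eval (fun i : Fin lam.length => (lam.part i : ℚ))
              (factorialSchurP mu lam.length) /
            fallingPow (lam.size : ℚ) mu.size) ∧
      (lam.dimension StrictPartition.empty : ℚ) =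
        ((lam.size.factorial : ℚ) / ∏ k : Fin lam.length, ((lam.part k).factorial : ℚ)) *
          ∏ i : Fin lam.length, ∏ j ∈ Ioi i,
            ((lam.part i : ℚ) - lam.part j) / ((lam.part i : ℚ) + lam.part j) := by
  classical
  have hempty : (lam.dimension StrictPartition.empty : ℚ) =
      lam.size.factorial * lam.normalizedDimension := by
    have h1 := lam.dimension_eq_rowSum lam.size StrictPartition.empty (Nat.zero_le _)
      (Nat.zero_add _)
    rwa [if_pos (subset_iff.2 fun i => Nat.zero_le _), show StrictPartition.empty.length = 0 from rfl,
      rowSum_zero, mul_one] at h1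
  refine ⟨?_, ?_⟩
  · have hl := length_le_of_subset h
    have hle := size_le_of_subset h
    have h1 := lam.dimension_eq_rowSum (lam.size - mu.size) mu hl (by omega)
    have h2 : MvPolynomial.eval (fun i : Fin lam.length => (lam.part i : ℚ))
        (factorialSchurP mu lam.length) = rowSum mu.part mu.length lam.ratParts :=
      -- With exponents `mu.part`, `rowSum` and `factorialSum` agree by definition.
      eval_factorialSchurP mu hl lam.ratParts lam.ratParts_injective
    have h3 : (lam.size.descFactorial mu.size : ℚ) ≠ 0 :=
      Nat.cast_ne_zero.2 (mt Nat.descFactorial_eq_zero_iff_lt.1 (not_lt.2 hle))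
    have h4 : ((lam.size - mu.size).factorial : ℚ) * lam.size.descFactorial mu.size =
        lam.size.factorial := by
      exact_mod_cast Nat.factorial_mul_descFactorial hle
    rw [if_pos h] at h1
    rw [h1, hempty, h2, fallingPow_natCast, ← h4]
    field_simp
  · rw [hempty, normalizedDimension]
    ring
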